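/- Let $\Omega\subseteq\mathbb R^n$ be an open convex set and let $\Psi:\Omega\to\mathbb R$ be of class $C^4$ and strongly convex: for some $m>0$, $\Psi-\frac m2|\cdot|^2$ is convex on $\Omega$. On the tube domain $T\Omega=\Omega+\sqrt{-1}\,\mathbb R^n\subseteq\mathbb C^n$ consider the Kähler Sasaki metric $\mathfrak h_{i\bar j}(x+\sqrt{-1}y)=\Psi_{ij}(x)$, where subscripts on $\Psi$ denote partial derivatives and $(\Psi^{pq})=(\Psi_{ij})^{-1}$. It has non-negative anti-bisectional curvature (NAB) if, at every point of $T\Omega$ and for all $u,v\in\mathbb R^n$, $$\mathfrak A(u,v)=\sum_{i,j,k,l}\Big(-\Psi_{ijkl}+\sum_{p,q}\Psi_{ijp}\Psi_{klq}\Psi^{pq}\Big)u_iu_jv_kv_l\ \ge 0 .$$ Let $c(x,y)=\Psi(x-y)$ be the $\Psi$-cost. For $X,Y\subseteq\mathbb R^n$ with $X-Y\subseteq\Omega$, say that $c$ satisfies (QuantConv) on $(X,Y)$ if the following two conditions hold. 1. For all $x_0\in X$ and $y_0,y_1\in Y$ there is a $c^*$-segment $y(t)$, $t\in[0,1]$,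 in $Y$ with respect to $x_0$ from $y_0$ to $y_1$, i.e. $y(0)=y_0$, $y(1)=y_1$, $y(t)\in Y$ and $D_xc(x_0,y(t))=(1-t)D_xc(x_0,y_0)+tD_xc(x_0,y_1)$; and for each such segment, all $x\in X$ and all $t\in[0,1]$, $$-c(x,y(t))+c(x,y_0)-\big(-c(x_0,y(t))+c(x_0,y_0)\big)\le t\,\big(-c(x,y_1)+c(x,y_0)-(-c(x_0,y_1)+c(x_0,y_0))\big).$$ 2. For all $y_0\in Y$ and $x_0,x_1\in X$ there is a $c$-segment $x(s)$, $s\in[0,1]$, in $X$ with respect to $y_0$ from $x_0$ to $x_1$, i.e. $x(0)=x_0$, $x(1)=x_1$, $x(s)\in X$ and $D_yc(x(s),y_0)=(1-s)D_yc(x_0,y_0)+sD_yc(x_1,y_0)$; and for each such segment, all $y\in Y$ and all $s\in[0,1]$, $$-c(x(s),y)+c(x_0,y)-\big(-c(x(s),y_0)+c(x_0,y_0)\big)\le s\,\big(-c(x_1,y)+c(x_0,y)-(-c(x_1,y_0)+c(x_0,y_0))\big).$$ Write $B(x,\varepsilon)$ for the open Euclidean ball, and consider the condition (U) there is $\varepsilon_0>0$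 such that for all $0<\varepsilon<\varepsilon_0$ and all $x_1,x_2\in\mathbb R^n$ with $B(x_1,\varepsilon)-B(x_2,\varepsilon)\subseteq\Omega$, the $\Psi$-cost satisfies (QuantConv) on $(B(x_1,\varepsilon),B(x_2,\varepsilon))$. Then: (a) $\mathfrak h$ has (NAB) if and only if for every compact $K\subseteq\Omega$ there is $\varepsilon>0$ such that for all $x_1,x_2\in\mathbb R^n$ with $x_1-x_2\in K$ one has $B(x_1,\varepsilon)-B(x_2,\varepsilon)\subseteq\Omega$ and the $\Psi$-cost satisfies (QuantConv) on $(B(x_1,\varepsilon),B(x_2,\varepsilon))$. (b) (U) implies that $\mathfrak h$ has (NAB). (c) If the third derivatives of $\Psi$ are bounded on $\Omega$ (in particular if $\Psi$ is bounded in $C^4$), then $\mathfrak h$ has (NAB) if and only if (U) holds. -/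

import Mathlib

open Set Metric
open scoped Pointwise

noncomputable section

/-- The standard coordinate vector `e_i` of `ℝⁿ`. -/
def coordVec {n : ℕ} (i : Fin n) : EuclideanSpace ℝ (Fin n) := EuclideanSpace.single i 1

/-- Second partial derivatives `Ψ_ij`. -/
def partial₂ {n : ℕ} (Ψ : EuclideanSpace ℝ (Fin n) → ℝ) (x : EuclideanSpace ℝ (Fin n))
    (i j : Fin n) : ℝ :=
  iteratedFDeriv ℝ 2 Ψ x ![coordVec i, coordVec j]

/-- Third partial derivatives `Ψ_ijk`. -/
def partial₃ {n : ℕ} (Ψ : EuclideanSpace ℝ (Fin n) → ℝ) (x : EuclideanSpace ℝ (Fin n))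
    (i j k : Fin n) : ℝ :=
  iteratedFDeriv ℝ 3 Ψ x ![coordVec i, coordVec j, coordVec k]

/-- Fourth partial derivatives `Ψ_ijkl`. -/
def partial₄ {n : ℕ} (Ψ : EuclideanSpace ℝ (Fin n) → ℝ) (x : EuclideanSpace ℝ (Fin n))
    (i j k l : Fin n) : ℝ :=
  iteratedFDeriv ℝ 4 Ψ x ![coordVec i, coordVec j, coordVec k, coordVec l]

/-- The tube domain `TΩ = {z = x + √-1 y : x ∈ Ω, y ∈ ℝⁿ}` in `ℂⁿ`. -/
def tubeDomain {n : ℕ} (Ω : Set (EuclideanSpace ℝ (Fin n))) : Set (EuclideanSpace ℂ (Fin n)) :=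
  {z | WithLp.toLp 2 (fun i => (z i).re) ∈ Ω}

/-- The coefficients `𝔥_{i j̄}(z) = Ψ_ij(x)`, `x = Re z`, of the Kähler Sasaki metric with
potential `Ψ` in the holomorphic coordinates of the tube domain; they are real and depend on `x`
only. -/
def kahlerSasakiMetric {n : ℕ} (Ψ : EuclideanSpace ℝ (Fin n) → ℝ)
    (x : EuclideanSpace ℝ (Fin n)) : Matrix (Fin n) (Fin n) ℝ :=
  Matrix.of fun i j => partial₂ Ψ x i j

/-- The anti-bisectional curvature
`𝔄(u,v) = ∑_{ijkl} (-Ψ_ijkl + ∑_{pq} Ψ_ijp Ψ_klq Ψ^pq) u_i u_j v_k v_l` of the Kähler Sasaki metric,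
at the points of the tube domain with real part `x`; `Ψ^pq` is the inverse of the metric matrix. -/
def antiBisectional {n : ℕ} (Ψ : EuclideanSpace ℝ (Fin n) → ℝ)
    (x u v : EuclideanSpace ℝ (Fin n)) : ℝ :=
  ∑ i, ∑ j, ∑ k, ∑ l,
    (-partial₄ Ψ x i j k l
      + ∑ p, ∑ q, partial₃ Ψ x i j p * partial₃ Ψ x k l q * (kahlerSasakiMetric Ψ x)⁻¹ p q)
      * u i * u j * v k * v l

/-- (NAB): the Kähler Sasaki metric with potential `Ψ` has non-negative anti-bisectional curvature
on the tube domain `TΩ`. -/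
def HasNAB {n : ℕ} (Ω : Set (EuclideanSpace ℝ (Fin n))) (Ψ : EuclideanSpace ℝ (Fin n) → ℝ) : Prop :=
  ∀ z ∈ tubeDomain Ω, ∀ u v : EuclideanSpace ℝ (Fin n),
    0 ≤ antiBisectional Ψ (WithLp.toLp 2 (fun i => (z i).re)) u v

/-- The `Ψ`-cost `c(x,y) = Ψ(x - y)`. -/
def psiCost {n : ℕ} (Ψ : EuclideanSpace ℝ (Fin n) → ℝ) (x y : EuclideanSpace ℝ (Fin n)) : ℝ :=
  Ψ (x - y)

/-- `γ`, restricted to `[0,1]`, is a `c*`-segment in `Y` with respect to `x₀` from `y₀` to `y₁`: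
`D_x c(x₀, γ(t))` runs affinely through the line segment from `D_x c(x₀,y₀)` to `D_x c(x₀,y₁)`. -/
def IsCStarSegment {n : ℕ} (c : EuclideanSpace ℝ (Fin n) → EuclideanSpace ℝ (Fin n) → ℝ)
    (Y : Set (EuclideanSpace ℝ (Fin n))) (x₀ y₀ y₁ : EuclideanSpace ℝ (Fin n))
    (γ : ℝ → EuclideanSpace ℝ (Fin n)) : Prop :=
  γ 0 = y₀ ∧ γ 1 = y₁ ∧ ∀ t ∈ Icc (0 : ℝ) 1, γ t ∈ Y ∧
    fderiv ℝ (fun x => c x (γ t)) x₀ =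
      (1 - t) • fderiv ℝ (fun x => c x y₀) x₀ + t • fderiv ℝ (fun x => c x y₁) x₀

/-- `σ`, restricted to `[0,1]`, is a `c`-segment in `X` with respect to `y₀` from `x₀` to `x₁`:
`D_y c(σ(s), y₀)` runs affinely through the line segment from `D_y c(x₀,y₀)` to `D_y c(x₁,y₀)`. -/
def IsCSegment {n : ℕ} (c : EuclideanSpace ℝ (Fin n) → EuclideanSpace ℝ (Fin n) → ℝ)
    (X : Set (EuclideanSpace ℝ (Fin n))) (y₀ x₀ x₁ : EuclideanSpace ℝ (Fin n))
    (σ : ℝ → EuclideanSpace ℝ (Fin n)) : Prop :=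
  σ 0 = x₀ ∧ σ 1 = x₁ ∧ ∀ s ∈ Icc (0 : ℝ) 1, σ s ∈ X ∧
    fderiv ℝ (fun y => c (σ s) y) y₀ =
      (1 - s) • fderiv ℝ (fun y => c x₀ y) y₀ + s • fderiv ℝ (fun y => c x₁ y) y₀

/-- The two inequalities of quantitative quasiconvexity on `X × Y` with the constant `M`.
The existence of the segments that they refer to is part of the condition, so that it never holds
for want of segments. -/
def QuantQuasiConvWith {n : ℕ} (M : ℝ)
    (c : EuclideanSpace ℝ (Fin n) → EuclideanSpace ℝ (Fin n) → ℝ)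
    (X Y : Set (EuclideanSpace ℝ (Fin n))) : Prop :=
  (∀ x₀ ∈ X, ∀ y₀ ∈ Y, ∀ y₁ ∈ Y,
    (∃ γ, IsCStarSegment c Y x₀ y₀ y₁ γ) ∧
    ∀ γ, IsCStarSegment c Y x₀ y₀ y₁ γ → ∀ x ∈ X, ∀ t ∈ Icc (0 : ℝ) 1,
      -c x (γ t) + c x y₀ - (-c x₀ (γ t) + c x₀ y₀)
        ≤ M * t * (-c x y₁ + c x y₀ - (-c x₀ y₁ + c x₀ y₀))) ∧
  (∀ y₀ ∈ Y, ∀ x₀ ∈ X, ∀ x₁ ∈ X,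
    (∃ σ, IsCSegment c X y₀ x₀ x₁ σ) ∧
    ∀ σ, IsCSegment c X y₀ x₀ x₁ σ → ∀ y ∈ Y, ∀ s ∈ Icc (0 : ℝ) 1,
      -c (σ s) y + c x₀ y - (-c (σ s) y₀ + c x₀ y₀)
        ≤ M * s * (-c x₁ y + c x₀ y - (-c x₁ y₀ + c x₀ y₀)))

/-- (QuantConv): quantitative convexity, the case `M = 1`. -/
def QuantConv {n : ℕ} (c : EuclideanSpace ℝ (Fin n) → EuclideanSpace ℝ (Fin n) → ℝ)
    (X Y : Set (EuclideanSpace ℝ (Fin n))) : Prop :=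
  QuantQuasiConvWith 1 c X Y

/-- The `Ψ`-cost satisfies (QuantConv) on all pairs of sufficiently small Euclidean balls of equal
radius, with one bound `ε₀` for the radii, on which the cost is defined (`X - Y ⊆ Ω`). -/
def QuantConvOnSmallBalls {n : ℕ} (Ω : Set (EuclideanSpace ℝ (Fin n)))
    (Ψ : EuclideanSpace ℝ (Fin n) → ℝ) : Prop :=
  ∃ ε₀ > (0 : ℝ), ∀ ε : ℝ, 0 < ε → ε < ε₀ → ∀ x₁ x₂ : EuclideanSpace ℝ (Fin n),
    ball x₁ ε - ball x₂ ε ⊆ Ω → QuantConv (psiCost Ψ) (ball x₁ ε) (ball x₂ ε)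

/-- The locally uniform version: on each compact subset `K` of `Ω` there is an `ε > 0` such that
the `Ψ`-cost is defined and satisfies (QuantConv) on all pairs of `ε`-balls with centres differing
by an element of `K`. -/
def QuantConvLocally {n : ℕ} (Ω : Set (EuclideanSpace ℝ (Fin n)))
    (Ψ : EuclideanSpace ℝ (Fin n) → ℝ) : Prop :=
  ∀ K : Set (EuclideanSpace ℝ (Fin n)), IsCompact K → K ⊆ Ω →
    ∃ ε > (0 : ℝ), ∀ x₁ x₂ : EuclideanSpace ℝ (Fin n), x₁ - x₂ ∈ K →
      ball x₁ ε - ball x₂ ε ⊆ Ω ∧ QuantConv (psiCost Ψ) (ball x₁ ε) (ball x₂ ε)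

end

/-! Put w = x - y. Since the derivatives of the cost are ±DΨ(x - y), c*-segments and c-segments both
become curves w in Ω along which DΨ is affine, and both inequalities say that t ↦ Ψ(w) - Ψ(w + e)
lies below its chord on [0,1], for a fixed shift e. Its second derivative is Q(w) - Q(w + e), where
Q(y) = D²Ψ(y)(w', w') + DΨ(y)w'' with w', w'' frozen. Differentiating the affine gradient twice
shows that w is a critical point of Q. Along a second curve v with affine gradient the term DΨ(v)w''
is affine, and the second derivative of -Q(v) is exactly the anti-bisectional curvature 𝔄(v', w').

Under (NAB), -Q is therefore convex along the gradient curve from w to w + e and stationary at w, so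
Q(w + e) ≤ Q(w) (`second_variation_nonneg`), which is the required convexity (`sub_le_of_nonneg`).
Conversely, convexity for all small e makes w a local maximum of Q, and the second-order condition
there is 𝔄 ≥ 0 (`antiBisectional_nonneg_at`).

The radius enters because these curves must exist: the gradient image of a ball of radius R is
convex once 2RC < m, with C a bound on the third derivatives there (`exists_fderiv_eq_of_ball`).
Such a C comes from compactness in (a) and from the hypothesis in (c); (b) uses only the converse
direction. -/

set_option maxSynthPendingDepth 3

open Filter Topology

/-- Second-order necessary condition for a local minimum on the line. -/
theorem IsLocalMin.second_deriv_nonneg {f f' : ℝ → ℝ} {x a : ℝ} (hmin : IsLocalMin f x)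
    (hf : ∀ᶠ y in 𝓝 x, HasDerivAt f (f' y) y) (hf' : HasDerivAt f' a x) : 0 ≤ a := by
  by_contra! ha
  have hd : deriv f =ᶠ[𝓝 x] f' := hf.mono fun y hy => hy.deriv
  have hdd : deriv (deriv f) x = a := (hf'.congr_of_eventuallyEq hd).deriv
  -- A negative second derivative would make the minimum a strict-looking maximum too; then f is
  -- locally constant and its second derivative vanishes.
  have hmax : IsLocalMax f x := isLocalMax_of_deriv_deriv_neg (by rw [hdd]; exact ha)
    hmin.deriv_eq_zero hf.self_of_nhds.continuousAt
  have hconst : f =ᶠ[𝓝 x] fun _ => f x := by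
    filter_upwards [hmin, hmax] with y h1 h2 using le_antisymm h2 h1
  have : deriv (deriv f) x = 0 := by
    rw [hconst.deriv.deriv_eq]; simp
  linarith

section Calculus

variable {E : Type*} [NormedAddCommGroup E] [InnerProductSpace ℝ E]

/-- The Hessian as a bilinear form. -/
noncomputable abbrev hess (Ψ : E → ℝ) : E → E →L[ℝ] E →L[ℝ] ℝ := fderiv ℝ (fderiv ℝ Ψ)

/-- The third derivative as a trilinear form. -/
noncomputable abbrev third (Ψ : E → ℝ) : E → E →L[ℝ] E →L[ℝ] E →L[ℝ] ℝ := fderiv ℝ (hess Ψ)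

/-- The fourth derivative as a quadrilinear form. -/
noncomputable abbrev fourth (Ψ : E → ℝ) : E → E →L[ℝ] E →L[ℝ] E →L[ℝ] E →L[ℝ] ℝ :=
  fderiv ℝ (third Ψ)

/-- `Ψ` is of class `C⁴` on the open convex set `Ω`, with Hessian bounded below by `m > 0`. -/
structure CoerciveHessianOn (Ω : Set E) (Ψ : E → ℝ) (m : ℝ) : Prop where
  isOpen : IsOpen Ω
  convex : Convex ℝ Ω
  contDiffOn : ContDiffOn ℝ 4 Ψ Ω
  pos : 0 < m
  le_hess : ∀ x ∈ Ω, ∀ k : E, m * ‖k‖ ^ 2 ≤ hess Ψ x k k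

/-- Non-negativity of the anti-bisectional curvature, in coordinate-free form. -/
def NonnegAntiBisectional (Ω : Set E) (Ψ : E → ℝ) : Prop :=
  ∀ x ∈ Ω, ∀ a b k : E, hess Ψ x k = third Ψ x a a →
    0 ≤ -fourth Ψ x a a b b + third Ψ x b b k

/-! ### Derivatives along curves and symmetry of the higher derivatives -/

section Derivatives

variable {Ω : Set E} {Ψ : E → ℝ}

theorem ContDiffOn.contDiffOn_fderiv_three (h : ContDiffOn ℝ 4 Ψ Ω) (hΩ : IsOpen Ω) :
    ContDiffOn ℝ 3 (fderiv ℝ Ψ) Ω := h.fderiv_of_isOpen hΩ (by norm_num)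

theorem ContDiffOn.contDiffOn_hess (h : ContDiffOn ℝ 4 Ψ Ω) (hΩ : IsOpen Ω) :
    ContDiffOn ℝ 2 (hess Ψ) Ω := (h.contDiffOn_fderiv_three hΩ).fderiv_of_isOpen hΩ (by norm_num)

theorem ContDiffOn.contDiffOn_third (h : ContDiffOn ℝ 4 Ψ Ω) (hΩ : IsOpen Ω) :
    ContDiffOn ℝ 1 (third Ψ) Ω := (h.contDiffOn_hess hΩ).fderiv_of_isOpen hΩ (by norm_num)

theorem ContDiffOn.hasFDerivAt_of_isOpen {F : Type*} [NormedAddCommGroup F] [NormedSpace ℝ F]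
    {f : E → F} {k : WithTop ℕ∞} (h : ContDiffOn ℝ k f Ω) (hk : k ≠ 0) (hΩ : IsOpen Ω) {x : E}
    (hx : x ∈ Ω) : HasFDerivAt f (fderiv ℝ f x) x :=
  ((h.contDiffAt (hΩ.mem_nhds hx)).differentiableAt hk).hasFDerivAt

variable {w : ℝ → E} {w' : E} {t : ℝ}

theorem ContDiffOn.hasDerivAt_comp (h : ContDiffOn ℝ 4 Ψ Ω) (hΩ : IsOpen Ω) (hx : w t ∈ Ω)
    (hw : HasDerivAt w w' t) : HasDerivAt (fun τ => Ψ (w τ)) (fderiv ℝ Ψ (w t) w') t :=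
  (h.hasFDerivAt_of_isOpen (by norm_num) hΩ hx).comp_hasDerivAt t hw

theorem ContDiffOn.hasDerivAt_fderiv_comp (h : ContDiffOn ℝ 4 Ψ Ω) (hΩ : IsOpen Ω) (hx : w t ∈ Ω)
    (hw : HasDerivAt w w' t) : HasDerivAt (fun τ => fderiv ℝ Ψ (w τ)) (hess Ψ (w t) w') t :=
  ((h.contDiffOn_fderiv_three hΩ).hasFDerivAt_of_isOpen (by norm_num) hΩ hx).comp_hasDerivAt t hw

theorem ContDiffOn.hasDerivAt_hess_comp (h : ContDiffOn ℝ 4 Ψ Ω) (hΩ : IsOpen Ω) (hx : w t ∈ Ω)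
    (hw : HasDerivAt w w' t) : HasDerivAt (fun τ => hess Ψ (w τ)) (third Ψ (w t) w') t :=
  ((h.contDiffOn_hess hΩ).hasFDerivAt_of_isOpen (by norm_num) hΩ hx).comp_hasDerivAt t hw

theorem ContDiffOn.hasDerivAt_third_comp (h : ContDiffOn ℝ 4 Ψ Ω) (hΩ : IsOpen Ω) (hx : w t ∈ Ω)
    (hw : HasDerivAt w w' t) : HasDerivAt (fun τ => third Ψ (w τ)) (fourth Ψ (w t) w') t :=
  ((h.contDiffOn_third hΩ).hasFDerivAt_of_isOpen (by norm_num) hΩ hx).comp_hasDerivAt t hw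

theorem ContDiffOn.hess_symm (h : ContDiffOn ℝ 4 Ψ Ω) (hΩ : IsOpen Ω) {x : E} (hx : x ∈ Ω)
    (a b : E) : hess Ψ x a b = hess Ψ x b a :=
  (h.contDiffAt (hΩ.mem_nhds hx)).isSymmSndFDerivAt
    (by rw [minSmoothness_of_isRCLikeNormedField]; norm_num) a b

theorem ContDiffOn.third_symm_left (h : ContDiffOn ℝ 4 Ψ Ω) (hΩ : IsOpen Ω) {x : E} (hx : x ∈ Ω)
    (a b : E) : third Ψ x a b = third Ψ x b a :=
  ((h.contDiffOn_fderiv_three hΩ).contDiffAt (hΩ.mem_nhds hx)).isSymmSndFDerivAt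
    (by rw [minSmoothness_of_isRCLikeNormedField]; norm_num) a b

theorem ContDiffOn.third_symm_right (h : ContDiffOn ℝ 4 Ψ Ω) (hΩ : IsOpen Ω) {x : E} (hx : x ∈ Ω)
    (a b c : E) : third Ψ x a b c = third Ψ x a c b := by
  have hH := (h.contDiffOn_hess hΩ).hasFDerivAt_of_isOpen (by norm_num) hΩ hx
  have h1 := ((hH.clm_apply (hasFDerivAt_const b x)).clm_apply (hasFDerivAt_const c x))
  have h2 := ((hH.clm_apply (hasFDerivAt_const c x)).clm_apply (hasFDerivAt_const b x))
  have he : (fun y => hess Ψ y b c) =ᶠ[𝓝 x] fun y => hess Ψ y c b := by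
    filter_upwards [hΩ.mem_nhds hx] with y hy using h.hess_symm hΩ hy b c
  have := congrArg (fun L => L a) ((h1.congr_of_eventuallyEq he.symm).unique h2)
  simpa using this

end Derivatives

theorem hasDerivAt_line (x k : E) (t : ℝ) : HasDerivAt (fun τ : ℝ => x + τ • k) k t := by
  simpa using ((hasDerivAt_id t).smul_const k).const_add x

/-- Midpoint convexity makes the symmetrised function t ↦ f(x + tk) + f(x - tk), with f = Ψ -
(m/2)|·|², minimal at t = 0, and its second derivative there is twice the quantity to be bounded. -/
theorem StrongConvexOn.coerciveHessianOn {Ω : Set E} {Ψ : E → ℝ} {m : ℝ}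
    (h : StrongConvexOn Ω m Ψ) (hm : 0 < m) (hΩ : IsOpen Ω) (hΩc : Convex ℝ Ω)
    (hΨ : ContDiffOn ℝ 4 Ψ Ω) : CoerciveHessianOn Ω Ψ m := by
  refine ⟨hΩ, hΩc, hΨ, hm, fun x hx k => ?_⟩
  have hc := (strongConvexOn_iff_convex.1 h).2
  have hmem : ∀ k : E, ∀ᶠ t : ℝ in 𝓝 0, x + t • k ∈ Ω := fun k => by
    have : ContinuousAt (fun t : ℝ => x + t • k) 0 := (hasDerivAt_line x k 0).continuousAt
    exact this.eventually_mem (hΩ.mem_nhds (by simpa using hx))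
  have hd : ∀ k : E, ∀ t : ℝ, x + t • k ∈ Ω → HasDerivAt
      (fun τ : ℝ => Ψ (x + τ • k) - m / 2 * ‖x + τ • k‖ ^ 2)
      (fderiv ℝ Ψ (x + t • k) k - m * inner ℝ (x + t • k) k) t := fun k t ht => by
    have := (hΨ.hasDerivAt_comp hΩ ht (hasDerivAt_line x k t)).sub
      ((hasDerivAt_line x k t).norm_sq.const_mul (m / 2))
    exact this.congr_deriv (by ring)
  have hd2 : ∀ k : E, HasDerivAt
      (fun τ : ℝ => fderiv ℝ Ψ (x + τ • k) k - m * inner ℝ (x + τ • k) k)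
      (hess Ψ x k k - m * ‖k‖ ^ 2) 0 := fun k => by
    have h1 := (hΨ.hasDerivAt_fderiv_comp hΩ (w := fun τ : ℝ => x + τ • k) (t := 0)
      (by simpa using hx) (hasDerivAt_line x k 0)).clm_apply (hasDerivAt_const 0 k)
    have h2 := ((hasDerivAt_line x k 0).inner ℝ (hasDerivAt_const 0 k)).const_mul m
    exact (h1.sub h2).congr_deriv (by simp)
  have hsum : IsLocalMin (fun τ : ℝ => (Ψ (x + τ • k) - m / 2 * ‖x + τ • k‖ ^ 2) +
      (Ψ (x + τ • -k) - m / 2 * ‖x + τ • -k‖ ^ 2)) 0 := by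
    filter_upwards [hmem k, hmem (-k)] with t h1 h2
    have := hc h1 h2 (a := 1 / 2) (b := 1 / 2) (by norm_num) (by norm_num) (by norm_num)
    have e : (1 / 2 : ℝ) • (x + t • k) + (1 / 2 : ℝ) • (x + t • -k) = x := by module
    simp only [e, smul_eq_mul] at this
    simp only [zero_smul, add_zero]
    linarith
  have := hsum.second_deriv_nonneg
    (by filter_upwards [hmem k, hmem (-k)] with t h1 h2 using (hd k t h1).add (hd (-k) t h2))
    ((hd2 k).add (hd2 (-k)))
  simp only [map_neg, neg_apply, neg_neg, norm_neg] at this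
  simp at this
  linarith

namespace CoerciveHessianOn

variable {Ω : Set E} {Ψ : E → ℝ} {m : ℝ} (h : CoerciveHessianOn Ω Ψ m)
include h

/-- On the segment from a to b the function DΨ(·)(b - a) has derivative at least m|b - a|², so it
cannot take equal values at the ends. -/
theorem injOn_fderiv : InjOn (fderiv ℝ Ψ) Ω := by
  intro a ha b hb hab
  by_contra hne
  have hmem : ∀ t ∈ Icc (0 : ℝ) 1, a + t • (b - a) ∈ Ω := fun t ht =>
    h.convex.add_smul_sub_mem ha hb ht
  have hd : ∀ t ∈ Icc (0 : ℝ) 1, HasDerivAt (fun τ : ℝ => fderiv ℝ Ψ (a + τ • (b - a)) (b - a))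
      (hess Ψ (a + t • (b - a)) (b - a) (b - a)) t := fun t ht => by
    have := (h.contDiffOn.hasDerivAt_fderiv_comp h.isOpen (hmem t ht)
      (hasDerivAt_line a (b - a) t)).clm_apply (hasDerivAt_const t (b - a))
    simpa using this
  obtain ⟨c, hc, he⟩ := exists_hasDerivAt_eq_slope _ _ zero_lt_one
    (fun t ht => (hd t ht).continuousAt.continuousWithinAt)
    (fun t ht => hd t (Ioo_subset_Icc_self ht))
  have h1 := h.le_hess _ (hmem c (Ioo_subset_Icc_self hc)) (b - a)
  have h2 : 0 < ‖b - a‖ := norm_pos_iff.2 (sub_ne_zero.2 (Ne.symm hne))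
  have h3 : 0 < m * ‖b - a‖ ^ 2 := mul_pos h.pos (by positivity)
  rw [he] at h1
  simp [hab] at h1
  linarith

/-- A Taylor estimate by two applications of the mean value theorem; this costs the factor 1/2 in
the remainder, which the smallness condition on the radius absorbs. -/
theorem fderiv_sub_apply_le {D : Set E} (hD : D ⊆ Ω) (hDc : Convex ℝ D) {C : ℝ} (hC0 : 0 ≤ C)
    (hC : ∀ x ∈ D, ∀ a b, third Ψ x a a b ≤ C * ‖a‖ ^ 2 * ‖b‖) {w a : E} (hw : w ∈ D)
    (ha : a ∈ D) (l : E) :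
    fderiv ℝ Ψ a l - fderiv ℝ Ψ w l ≤ hess Ψ w (a - w) l + C * ‖a - w‖ ^ 2 * ‖l‖ := by
  have hmem : ∀ t ∈ Icc (0 : ℝ) 1, w + t • (a - w) ∈ D := fun t ht =>
    hDc.add_smul_sub_mem hw ha ht
  have hd1 : ∀ t ∈ Icc (0 : ℝ) 1, HasDerivAt (fun τ : ℝ => fderiv ℝ Ψ (w + τ • (a - w)) l)
      (hess Ψ (w + t • (a - w)) (a - w) l) t := fun t ht =>
    ((h.contDiffOn.hasDerivAt_fderiv_comp h.isOpen (hD (hmem t ht))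
      (hasDerivAt_line w (a - w) t)).clm_apply (hasDerivAt_const t l)).congr_deriv (by simp)
  have hd2 : ∀ t ∈ Icc (0 : ℝ) 1, HasDerivAt (fun τ : ℝ => hess Ψ (w + τ • (a - w)) (a - w) l)
      (third Ψ (w + t • (a - w)) (a - w) (a - w) l) t := fun t ht =>
    (((h.contDiffOn.hasDerivAt_hess_comp h.isOpen (hD (hmem t ht))
      (hasDerivAt_line w (a - w) t)).clm_apply (hasDerivAt_const t (a - w))).clm_apply
      (hasDerivAt_const t l)).congr_deriv (by simp)
  obtain ⟨ξ, hξ, he⟩ := exists_hasDerivAt_eq_slope _ _ zero_lt_one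
    (fun t ht => (hd1 t ht).continuousAt.continuousWithinAt)
    (fun t ht => hd1 t (Ioo_subset_Icc_self ht))
  have hsub : Icc 0 ξ ⊆ Icc (0 : ℝ) 1 := Icc_subset_Icc_right hξ.2.le
  obtain ⟨η, hη, he2⟩ := exists_hasDerivAt_eq_slope _ _ hξ.1
    (fun t ht => (hd2 t (hsub ht)).continuousAt.continuousWithinAt)
    (fun t ht => hd2 t (hsub (Ioo_subset_Icc_self ht)))
  have hb := hC _ (hmem η (hsub (Ioo_subset_Icc_self hη))) (a - w) l
  rw [he2, div_le_iff₀ (by linarith [hξ.1]), he] at hb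
  have hM : 0 ≤ C * ‖a - w‖ ^ 2 * ‖l‖ := by positivity
  simp only [one_smul, zero_smul, add_zero, sub_zero, div_one, add_sub_cancel] at hb
  nlinarith [hξ.2]

/-! ### Inverting the gradient map -/

variable [FiniteDimensional ℝ E]

theorem exists_equiv {x : E} (hx : x ∈ Ω) :
    ∃ L : E ≃L[ℝ] (E →L[ℝ] ℝ), (L : E →L[ℝ] E →L[ℝ] ℝ) = hess Ψ x := by
  have hinj : Function.Injective (hess Ψ x).toLinearMap := by
    rw [← LinearMap.ker_eq_bot, LinearMap.ker_eq_bot']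
    intro k hk
    have h1 := h.le_hess x hx k
    have h2 : hess Ψ x k = 0 := hk
    rw [h2] at h1
    by_contra hne
    have h3 : 0 < ‖k‖ := norm_pos_iff.2 hne
    have h4 : 0 < m * ‖k‖ ^ 2 := mul_pos h.pos (by positivity)
    simp at h1
    linarith
  have hdim : Module.finrank ℝ E = Module.finrank ℝ (E →L[ℝ] ℝ) := by
    rw [← (LinearMap.toContinuousLinearMap (𝕜 := ℝ) (E := E) (F' := ℝ)).finrank_eq]
    exact (Subspace.dual_finrank_eq (K := ℝ) (V := E)).symm
  refine ⟨(LinearMap.linearEquivOfInjective _ hinj hdim).toContinuousLinearEquiv, ?_⟩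
  ext1 k
  rfl

theorem exists_hess_eq {x : E} (hx : x ∈ Ω) (p : E →L[ℝ] ℝ) : ∃ k, hess Ψ x k = p := by
  obtain ⟨L, hL⟩ := h.exists_equiv hx
  exact ⟨L.symm p, by rw [← hL]; simp⟩

/-- The gradient map of `Ψ` has an open image, on which its inverse is of class `C²`. -/
theorem exists_inverse_fderiv : ∃ G : (E →L[ℝ] ℝ) → E, IsOpen (fderiv ℝ Ψ '' Ω) ∧
    (∀ x ∈ Ω, G (fderiv ℝ Ψ x) = x) ∧ ∀ p ∈ fderiv ℝ Ψ '' Ω, ContDiffAt ℝ 2 G p := by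
  have hleft : ∀ x ∈ Ω, Function.invFunOn (fderiv ℝ Ψ) Ω (fderiv ℝ Ψ x) = x := fun x hx =>
    h.injOn_fderiv.leftInvOn_invFunOn hx
  have key : ∀ x ∈ Ω, ∃ g : (E →L[ℝ] ℝ) → E, ContDiffAt ℝ 2 g (fderiv ℝ Ψ x) ∧
      ∀ᶠ p in 𝓝 (fderiv ℝ Ψ x), g p ∈ Ω ∧ fderiv ℝ Ψ (g p) = p := by
    intro x hx
    obtain ⟨L, hL⟩ := h.exists_equiv hx
    have hc : ContDiffAt ℝ 2 (fderiv ℝ Ψ) x :=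
      ((h.contDiffOn.contDiffOn_fderiv_three h.isOpen).contDiffAt (h.isOpen.mem_nhds hx)).of_le
        (by norm_num)
    have hd : HasFDerivAt (fderiv ℝ Ψ) (L : E →L[ℝ] E →L[ℝ] ℝ) x := by
      rw [hL]
      exact (h.contDiffOn.contDiffOn_fderiv_three h.isOpen).hasFDerivAt_of_isOpen
        (by norm_num) h.isOpen hx
    have hs := hc.hasStrictFDerivAt' hd (by norm_num)
    refine ⟨hc.localInverse hd (by norm_num), hc.to_localInverse hd (by norm_num), ?_⟩
    exact (hs.localInverse_tendsto.eventually (h.isOpen.mem_nhds hx)).and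
      hs.eventually_right_inverse
  refine ⟨Function.invFunOn (fderiv ℝ Ψ) Ω, ?_, hleft, ?_⟩
  · rw [isOpen_iff_mem_nhds]
    rintro _ ⟨x, hx, rfl⟩
    obtain ⟨g, -, hg⟩ := key x hx
    filter_upwards [hg] with p hp using ⟨g p, hp.1, hp.2⟩
  · rintro _ ⟨x, hx, rfl⟩
    obtain ⟨g, hgc, hg⟩ := key x hx
    -- The local inverse takes values in Ω near the point, so by injectivity it coincides there with
    -- the global one.
    refine hgc.congr_of_eventuallyEq ?_
    filter_upwards [hg] with p hp
    conv_lhs => rw [← hp.2]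
    exact hleft _ hp.1

/-- Curves with affine gradient are twice differentiable, with the expected derivatives. -/
theorem exists_gradient_curve (p q : E →L[ℝ] ℝ) : ∃ w w₁ w₂ : ℝ → E,
    IsOpen {t : ℝ | p + t • q ∈ fderiv ℝ Ψ '' Ω} ∧ ∀ t : ℝ, p + t • q ∈ fderiv ℝ Ψ '' Ω →
      w t ∈ Ω ∧ fderiv ℝ Ψ (w t) = p + t • q ∧ HasDerivAt w (w₁ t) t ∧ HasDerivAt w₁ (w₂ t) t ∧
      hess Ψ (w t) (w₁ t) = q ∧ third Ψ (w t) (w₁ t) (w₁ t) + hess Ψ (w t) (w₂ t) = 0 := by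
  obtain ⟨G, hopen, hG, hGc⟩ := h.exists_inverse_fderiv
  have hℓ : ContDiff ℝ 2 fun t : ℝ => p + t • q := by fun_prop
  have hU : IsOpen {t : ℝ | p + t • q ∈ fderiv ℝ Ψ '' Ω} := hopen.preimage hℓ.continuous
  set w : ℝ → E := fun t => G (p + t • q) with hw
  have hmem : ∀ t : ℝ, p + t • q ∈ fderiv ℝ Ψ '' Ω → w t ∈ Ω ∧ fderiv ℝ Ψ (w t) = p + t • q := by
    rintro t ⟨x, hx, hxt⟩
    have : w t = x := by simp only [hw, ← hxt, hG x hx]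
    rw [this]; exact ⟨hx, hxt⟩
  have hwc : ContDiffOn ℝ 2 w {t : ℝ | p + t • q ∈ fderiv ℝ Ψ '' Ω} := fun t ht =>
    ((hGc _ ht).comp t hℓ.contDiffAt).contDiffWithinAt
  have hw1c : ContDiffOn ℝ 1 (deriv w) {t : ℝ | p + t • q ∈ fderiv ℝ Ψ '' Ω} :=
    hwc.deriv_of_isOpen hU (by norm_num)
  have hd1 : ∀ t : ℝ, p + t • q ∈ fderiv ℝ Ψ '' Ω → HasDerivAt w (deriv w t) t := fun t ht =>
    ((hwc.contDiffAt (hU.mem_nhds ht)).differentiableAt (by norm_num)).hasDerivAt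
  have hd2 : ∀ t : ℝ, p + t • q ∈ fderiv ℝ Ψ '' Ω →
      HasDerivAt (deriv w) (deriv (deriv w) t) t := fun t ht =>
    ((hw1c.contDiffAt (hU.mem_nhds ht)).differentiableAt (by norm_num)).hasDerivAt
  have hq : ∀ t : ℝ, p + t • q ∈ fderiv ℝ Ψ '' Ω → hess Ψ (w t) (deriv w t) = q := by
    intro t ht
    have h1 := h.contDiffOn.hasDerivAt_fderiv_comp h.isOpen (hmem t ht).1 (hd1 t ht)
    have he : (fun τ => fderiv ℝ Ψ (w τ)) =ᶠ[𝓝 t] fun τ => p + τ • q := by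
      filter_upwards [hU.mem_nhds ht] with τ hτ using (hmem τ hτ).2
    have h2 : HasDerivAt (fun τ : ℝ => p + τ • q) q t := by
      simpa using ((hasDerivAt_id t).smul_const q).const_add p
    exact (h1.congr_of_eventuallyEq he.symm).unique h2
  refine ⟨w, deriv w, deriv (deriv w), hU, fun t ht =>
    ⟨(hmem t ht).1, (hmem t ht).2, hd1 t ht, hd2 t ht, hq t ht, ?_⟩⟩
  -- The last identity is the derivative of the constant `hess Ψ (w t) (w₁ t) = q`.
  have h1 := (h.contDiffOn.hasDerivAt_hess_comp h.isOpen (hmem t ht).1 (hd1 t ht)).clm_apply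
    (hd2 t ht)
  have he : (fun τ => hess Ψ (w τ) (deriv w τ)) =ᶠ[𝓝 t] fun _ => q := by
    filter_upwards [hU.mem_nhds ht] with τ hτ using hq τ hτ
  exact (h1.congr_of_eventuallyEq he.symm).unique (hasDerivAt_const t q)

/-- On a ball whose radius is small compared with the modulus of convexity and the bound on the
third derivatives, the gradient map has a convex image. -/
theorem exists_fderiv_eq_of_ball {z : E} {R C : ℝ} (hball : ball z R ⊆ Ω) (hC0 : 0 ≤ C)
    (hC : ∀ x ∈ ball z R, ∀ a b, third Ψ x a a b ≤ C * ‖a‖ ^ 2 * ‖b‖) (hR : 2 * R * C < m)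
    {a b : E} (ha : a ∈ ball z R) (hb : b ∈ ball z R) {t : ℝ} (ht : t ∈ Icc (0 : ℝ) 1) :
    ∃ w ∈ ball z R, fderiv ℝ Ψ w = (1 - t) • fderiv ℝ Ψ a + t • fderiv ℝ Ψ b := by
  set p := (1 - t) • fderiv ℝ Ψ a + t • fderiv ℝ Ψ b with hp
  -- The preimage of p is sought as a minimiser of Ψ - p on the smallest closed ball about z that
  -- contains a and b.
  set r := max (dist a z) (dist b z) with hr
  have hrR : r < R := max_lt ha hb
  have hr0 : 0 ≤ r := le_max_of_le_left dist_nonneg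
  have hS : closedBall z r ⊆ ball z R := closedBall_subset_ball hrR
  have hcont : ContinuousOn (fun x => Ψ x - p x) (closedBall z r) :=
    (h.contDiffOn.continuousOn.mono (hS.trans hball)).sub p.continuous.continuousOn
  obtain ⟨w, hwS, hmin⟩ := (isCompact_closedBall z r).exists_isMinOn
    ⟨z, mem_closedBall_self hr0⟩ hcont
  have hwR := hS hwS
  refine ⟨w, hwR, ?_⟩
  by_contra hne
  -- Were w not critical, the Newton direction k would be a descent direction. It is preferred to
  -- the gradient because its pairing with the normal can be computed. It remains to see that it
  -- points into the ball.
  obtain ⟨k, hk⟩ := h.exists_hess_eq (hball hwR) (p - fderiv ℝ Ψ w)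
  have hk0 : 0 < ‖k‖ := norm_pos_iff.2 fun hk0 => hne (by
    rw [hk0, map_zero] at hk
    exact (sub_eq_zero.1 hk.symm).symm)
  have hdesc : 0 < p k - fderiv ℝ Ψ w k := by
    have h1 := h.le_hess w (hball hwR) k
    rw [hk] at h1
    have : 0 < m * ‖k‖ ^ 2 := mul_pos h.pos (by positivity)
    simpa using this.trans_le h1
  have hin : ∃ s : ℝ, 0 < s ∧ w + s • k ∈ closedBall z r := by
    have hc : Continuous fun s : ℝ => w + s • k := by fun_prop
    rcases lt_or_eq_of_le (mem_closedBall.1 hwS) with hlt | heq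
    · have : ∀ᶠ s : ℝ in 𝓝 0, w + s • k ∈ ball z r :=
        hc.continuousAt.eventually_mem (isOpen_ball.mem_nhds (by simpa using hlt))
      obtain ⟨s, hs, hs0⟩ := ((this.filter_mono nhdsWithin_le_nhds).and
        (self_mem_nhdsWithin (s := Ioi (0 : ℝ)))).exists
      exact ⟨s, hs0, ball_subset_closedBall hs⟩
    -- On the sphere, with l the vector dual to the normal ν under the Hessian, ⟨ν, k⟩ = (p -
    -- DΨ(w))l is an average of gradient differences from w to a and to b. Taylor's estimate, ⟨ν, a
    -- - w⟩ ≤ -|a - w|²/2 and |l| ≤ r/m make it negative when 2rC < m.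
    · set ν := w - z with hν
      have hνr : ‖ν‖ = r := by rw [hν, ← dist_eq_norm, heq]
      obtain ⟨l, hl⟩ := h.exists_hess_eq (hball hwR) (innerSL ℝ ν)
      have hlk : inner ℝ ν k = p l - fderiv ℝ Ψ w l := by
        rw [← sub_apply, ← hk, h.contDiffOn.hess_symm h.isOpen (hball hwR), hl]; simp
      have hlx : ∀ x, hess Ψ w x l = inner ℝ ν x := fun x => by
        rw [h.contDiffOn.hess_symm h.isOpen (hball hwR), hl]; simp
      have hln : m * ‖l‖ ≤ r := by
        rcases eq_or_lt_of_le (norm_nonneg l) with h0 | h0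
        · rw [← h0]; simpa using hr0
        · have h1 := h.le_hess w (hball hwR) l
          rw [hlx] at h1
          have h2 := real_inner_le_norm ν l
          rw [hνr] at h2
          nlinarith
      have hside : ∀ x, dist x z ≤ r → inner ℝ ν (x - w) ≤ -(‖x - w‖ ^ 2 / 2) := fun x hx => by
        have h1 : x - z = (x - w) + ν := by rw [hν]; abel
        have h2 := norm_add_sq_real (x - w) ν
        rw [← h1, ← dist_eq_norm, hνr, real_inner_comm] at h2
        nlinarith [dist_nonneg (x := x) (y := z)]
      have hstep : ∀ x, dist x z ≤ r → x ∈ ball z R → m * (fderiv ℝ Ψ x l - fderiv ℝ Ψ w l) ≤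
          -((m - 2 * r * C) * ‖x - w‖ ^ 2 / 2) := fun x hx hxR => by
        have h1 := h.fderiv_sub_apply_le hball (convex_ball z R) hC0 hC hwR hxR l
        rw [hlx] at h1
        have h2 := hside x hx
        have h3 : m * (C * ‖x - w‖ ^ 2 * ‖l‖) ≤ r * C * ‖x - w‖ ^ 2 := by
          have : 0 ≤ C * ‖x - w‖ ^ 2 := by positivity
          nlinarith
        have h4 := mul_le_mul_of_nonneg_left (h1.trans (add_le_add_left h2 _)) h.pos.le
        linarith
      have hgap : 0 < m - 2 * r * C := by nlinarith
      have hA := hstep a (le_max_left _ _) ha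
      have hB := hstep b (le_max_right _ _) hb
      -- If both weighted distances vanished, p would already be the gradient at w.
      have hQ : 0 < (1 - t) * ‖a - w‖ ^ 2 + t * ‖b - w‖ ^ 2 := by
        by_contra! hQ
        have h1 : 0 ≤ (1 - t) * ‖a - w‖ ^ 2 := mul_nonneg (by linarith [ht.2]) (by positivity)
        have h2 : 0 ≤ t * ‖b - w‖ ^ 2 := mul_nonneg ht.1 (by positivity)
        have h3 : (1 - t) * ‖a - w‖ ^ 2 = 0 := by linarith
        have h4 : t * ‖b - w‖ ^ 2 = 0 := by linarith
        have h5 : (1 - t) • fderiv ℝ Ψ a = (1 - t) • fderiv ℝ Ψ w := by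
          rcases mul_eq_zero.1 h3 with h | h
          · simp [h]
          · rw [sub_eq_zero.1 (norm_eq_zero.1 (pow_eq_zero_iff two_ne_zero |>.1 h))]
        have h6 : t • fderiv ℝ Ψ b = t • fderiv ℝ Ψ w := by
          rcases mul_eq_zero.1 h4 with h | h
          · simp [h]
          · rw [sub_eq_zero.1 (norm_eq_zero.1 (pow_eq_zero_iff two_ne_zero |>.1 h))]
        exact hne (by rw [hp, h5, h6]; module)
      have hneg : inner ℝ ν k < 0 := by
        have h1 : p l - fderiv ℝ Ψ w l = (1 - t) * (fderiv ℝ Ψ a l - fderiv ℝ Ψ w l) +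
            t * (fderiv ℝ Ψ b l - fderiv ℝ Ψ w l) := by
          rw [hp]; simp; ring
        have h2 := mul_le_mul_of_nonneg_left hA (by linarith [ht.2] : 0 ≤ 1 - t)
        have h3 := mul_le_mul_of_nonneg_left hB ht.1
        have h4 := mul_pos hgap hQ
        rw [hlk, h1]
        by_contra! hcon
        have h5 := mul_nonneg h.pos.le hcon
        nlinarith
      have hev : ∀ᶠ s : ℝ in 𝓝 0, 2 * inner ℝ ν k + s * ‖k‖ ^ 2 < 0 := by
        have hc : Continuous fun s : ℝ => 2 * inner ℝ ν k + s * ‖k‖ ^ 2 := by fun_prop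
        exact hc.continuousAt.eventually_lt continuousAt_const (by simp; linarith)
      obtain ⟨s, hs, hs0⟩ := ((hev.filter_mono nhdsWithin_le_nhds).and
        (self_mem_nhdsWithin (s := Ioi (0 : ℝ)))).exists
      have hs0 : 0 < s := hs0
      refine ⟨s, hs0, ?_⟩
      rw [mem_closedBall, dist_eq_norm]
      have h1 : w + s • k - z = ν + s • k := by rw [hν]; abel
      have h2 := norm_add_sq_real ν (s • k)
      rw [norm_smul, mul_pow, Real.norm_eq_abs, sq_abs, real_inner_smul_right, hνr] at h2
      rw [h1]
      refine le_of_sq_le_sq ?_ hr0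
      nlinarith
  obtain ⟨s, hs0, hs⟩ := hin
  have hf : HasFDerivWithinAt (fun x => Ψ x - p x) (fderiv ℝ Ψ w - p) (closedBall z r) w :=
    ((h.contDiffOn.hasFDerivAt_of_isOpen (by norm_num) h.isOpen (hball hwR)).sub
      p.hasFDerivAt).hasFDerivWithinAt
  have hcone : s • k ∈ posTangentConeAt (closedBall z r) w :=
    mem_posTangentConeAt_of_segment_subset ((convex_closedBall z r).segment_subset hwS hs)
  have := hmin.localize.hasFDerivWithinAt_nonneg hf hcone
  simp at this
  nlinarith

/-! ### Second variation: from curvature to convexity -/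

/-- The second derivative of `t ↦ Ψ (w t) - Ψ (w t + e)` along a curve `w` with affine gradient is
non-negative, if the curvature is. -/
theorem second_variation_nonneg (hA : NonnegAntiBisectional Ω Ψ) {x y w₁ w₂ : E} (hx : x ∈ Ω)
    (hy : y ∈ Ω) (hseg : ∀ s ∈ Icc (0 : ℝ) 1, ∃ c ∈ Ω,
      fderiv ℝ Ψ c = (1 - s) • fderiv ℝ Ψ x + s • fderiv ℝ Ψ y)
    (hw : third Ψ x w₁ w₁ + hess Ψ x w₂ = 0) :
    hess Ψ y w₁ w₁ + fderiv ℝ Ψ y w₂ ≤ hess Ψ x w₁ w₁ + fderiv ℝ Ψ x w₂ := by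
  obtain ⟨v, v₁, v₂, -, hv⟩ := h.exists_gradient_curve (fderiv ℝ Ψ x)
    (fderiv ℝ Ψ y - fderiv ℝ Ψ x)
  have himg : ∀ s ∈ Icc (0 : ℝ) 1,
      fderiv ℝ Ψ x + s • (fderiv ℝ Ψ y - fderiv ℝ Ψ x) ∈ fderiv ℝ Ψ '' Ω := fun s hs => by
    obtain ⟨c, hc, he⟩ := hseg s hs
    exact ⟨c, hc, by rw [he]; module⟩
  have h0 : (0 : ℝ) ∈ Icc (0 : ℝ) 1 := by simp
  have h1 : (1 : ℝ) ∈ Icc (0 : ℝ) 1 := by simp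
  have hv0 : v 0 = x := h.injOn_fderiv (hv 0 (himg 0 h0)).1 hx
    (by rw [(hv 0 (himg 0 h0)).2.1]; module)
  have hv1 : v 1 = y := h.injOn_fderiv (hv 1 (himg 1 h1)).1 hy
    (by rw [(hv 1 (himg 1 h1)).2.1]; module)
  have hd1 : ∀ s ∈ Icc (0 : ℝ) 1, HasDerivAt
      (fun s => -(hess Ψ (v s) w₁ w₁ + fderiv ℝ Ψ (v s) w₂))
      (-(third Ψ (v s) (v₁ s) w₁ w₁ + (fderiv ℝ Ψ y - fderiv ℝ Ψ x) w₂)) s := fun s hs => by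
    obtain ⟨hm, -, hv', -, hq, -⟩ := hv s (himg s hs)
    have e1 := ((h.contDiffOn.hasDerivAt_hess_comp h.isOpen hm hv').clm_apply
      (hasDerivAt_const s w₁)).clm_apply (hasDerivAt_const s w₁)
    have e2 := (h.contDiffOn.hasDerivAt_fderiv_comp h.isOpen hm hv').clm_apply
      (hasDerivAt_const s w₂)
    rw [hq] at e2
    exact (e1.add e2).neg.congr_deriv (by simp)
  have hd2 : ∀ s ∈ Icc (0 : ℝ) 1, HasDerivAt
      (fun s => -(third Ψ (v s) (v₁ s) w₁ w₁ + (fderiv ℝ Ψ y - fderiv ℝ Ψ x) w₂))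
      (-(fourth Ψ (v s) (v₁ s) (v₁ s) w₁ w₁ + third Ψ (v s) (v₂ s) w₁ w₁)) s := fun s hs => by
    obtain ⟨hm, -, hv', hv'', -, -⟩ := hv s (himg s hs)
    have e1 := (((h.contDiffOn.hasDerivAt_third_comp h.isOpen hm hv').clm_apply hv'').clm_apply
      (hasDerivAt_const s w₁)).clm_apply (hasDerivAt_const s w₁)
    exact (e1.add_const _).neg.congr_deriv (by simp)
  have hpos : ∀ s ∈ Icc (0 : ℝ) 1,
      0 ≤ -(fourth Ψ (v s) (v₁ s) (v₁ s) w₁ w₁ + third Ψ (v s) (v₂ s) w₁ w₁) := fun s hs => by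
    obtain ⟨hm, -, -, -, -, hz⟩ := hv s (himg s hs)
    -- By the equation for v₂, the vector k paired with a = v₁ is -v₂.
    have := hA (v s) hm (v₁ s) w₁ (-v₂ s) (by
      rw [map_neg]; exact (eq_neg_of_add_eq_zero_left hz).symm)
    rw [map_neg, h.contDiffOn.third_symm_right h.isOpen hm,
      h.contDiffOn.third_symm_left h.isOpen hm] at this
    rw [h.contDiffOn.third_symm_left h.isOpen hm] at this ⊢
    linarith
  have hmono1 : MonotoneOn
      (fun s => -(third Ψ (v s) (v₁ s) w₁ w₁ + (fderiv ℝ Ψ y - fderiv ℝ Ψ x) w₂))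
      (Icc (0 : ℝ) 1) :=
    monotoneOn_of_hasDerivWithinAt_nonneg (convex_Icc 0 1)
      (fun s hs => (hd2 s hs).continuousAt.continuousWithinAt)
      (fun s hs => (hd2 s (interior_subset hs)).hasDerivWithinAt)
      (fun s hs => hpos s (interior_subset hs))
  -- The equation `hw`, tested on v₁, says that x is critical for the function being compared.
  have hzero : -(third Ψ (v 0) (v₁ 0) w₁ w₁ + (fderiv ℝ Ψ y - fderiv ℝ Ψ x) w₂) = 0 := by
    obtain ⟨-, -, -, -, hq, -⟩ := hv 0 (himg 0 h0)
    have e := congrArg (fun L => L (v₁ 0)) hw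
    simp only [add_apply, zero_apply] at e
    rw [hv0] at hq
    rw [h.contDiffOn.third_symm_right h.isOpen hx, h.contDiffOn.third_symm_left h.isOpen hx,
      h.contDiffOn.hess_symm h.isOpen hx, hq] at e
    rw [hv0]
    linarith
  have hmono : MonotoneOn (fun s => -(hess Ψ (v s) w₁ w₁ + fderiv ℝ Ψ (v s) w₂))
      (Icc (0 : ℝ) 1) :=
    monotoneOn_of_hasDerivWithinAt_nonneg (convex_Icc 0 1)
      (fun s hs => (hd1 s hs).continuousAt.continuousWithinAt)
      (fun s hs => (hd1 s (interior_subset hs)).hasDerivWithinAt)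
      (fun s hs => hzero.symm.le.trans
        (hmono1 h0 (interior_subset hs) (interior_subset hs).1))
  have := hmono h0 h1 zero_le_one
  simp only [hv0, hv1] at this
  linarith

/-- Quantitative convexity along a curve with affine gradient. -/
theorem sub_le_of_nonneg (hA : NonnegAntiBisectional Ω Ψ) {γ : ℝ → E} {e : E}
    (hγ : ∀ t ∈ Icc (0 : ℝ) 1, γ t ∈ Ω ∧ γ t + e ∈ Ω)
    (haff : ∀ t ∈ Icc (0 : ℝ) 1,
      fderiv ℝ Ψ (γ t) = (1 - t) • fderiv ℝ Ψ (γ 0) + t • fderiv ℝ Ψ (γ 1))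
    (hseg : ∀ t ∈ Icc (0 : ℝ) 1, ∀ s ∈ Icc (0 : ℝ) 1, ∃ c ∈ Ω,
      fderiv ℝ Ψ c = (1 - s) • fderiv ℝ Ψ (γ t) + s • fderiv ℝ Ψ (γ t + e))
    {t : ℝ} (ht : t ∈ Icc (0 : ℝ) 1) :
    (Ψ (γ t) - Ψ (γ t + e)) - (Ψ (γ 0) - Ψ (γ 0 + e)) ≤
      t * ((Ψ (γ 1) - Ψ (γ 1 + e)) - (Ψ (γ 0) - Ψ (γ 0 + e))) := by
  obtain ⟨w, w₁, w₂, -, hw⟩ := h.exists_gradient_curve (fderiv ℝ Ψ (γ 0))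
    (fderiv ℝ Ψ (γ 1) - fderiv ℝ Ψ (γ 0))
  have himg : ∀ t ∈ Icc (0 : ℝ) 1, fderiv ℝ Ψ (γ 0) + t • (fderiv ℝ Ψ (γ 1) - fderiv ℝ Ψ (γ 0)) =
      fderiv ℝ Ψ (γ t) := fun t ht => by rw [haff t ht]; module
  -- No regularity of γ is assumed: injectivity of the gradient identifies it with the smooth curve.
  have hw' : ∀ t ∈ Icc (0 : ℝ) 1, w t = γ t ∧ HasDerivAt w (w₁ t) t ∧ HasDerivAt w₁ (w₂ t) t ∧
      third Ψ (w t) (w₁ t) (w₁ t) + hess Ψ (w t) (w₂ t) = 0 := fun t ht => by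
    obtain ⟨hm, hF, hd1, hd2, -, hz⟩ := hw t (by rw [himg t ht]; exact ⟨γ t, (hγ t ht).1, rfl⟩)
    exact ⟨h.injOn_fderiv hm (hγ t ht).1 (hF.trans (himg t ht)), hd1, hd2, hz⟩
  have hd1 : ∀ t ∈ Icc (0 : ℝ) 1, HasDerivAt (fun t => Ψ (w t) - Ψ (w t + e))
      (fderiv ℝ Ψ (w t) (w₁ t) - fderiv ℝ Ψ (w t + e) (w₁ t)) t := fun t ht => by
    obtain ⟨hwt, hd, -, -⟩ := hw' t ht
    exact (h.contDiffOn.hasDerivAt_comp h.isOpen (by rw [hwt]; exact (hγ t ht).1) hd).sub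
      (h.contDiffOn.hasDerivAt_comp (w := fun t => w t + e) h.isOpen
        (by rw [hwt]; exact (hγ t ht).2) (hd.add_const e))
  have hd2 : ∀ t ∈ Icc (0 : ℝ) 1, HasDerivAt
      (fun t => fderiv ℝ Ψ (w t) (w₁ t) - fderiv ℝ Ψ (w t + e) (w₁ t))
      ((hess Ψ (w t) (w₁ t) (w₁ t) + fderiv ℝ Ψ (w t) (w₂ t)) -
        (hess Ψ (w t + e) (w₁ t) (w₁ t) + fderiv ℝ Ψ (w t + e) (w₂ t))) t := fun t ht => by
    obtain ⟨hwt, hd, hdd, -⟩ := hw' t ht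
    exact ((h.contDiffOn.hasDerivAt_fderiv_comp h.isOpen (by rw [hwt]; exact (hγ t ht).1)
      hd).clm_apply hdd).sub ((h.contDiffOn.hasDerivAt_fderiv_comp (w := fun t => w t + e) h.isOpen
        (by rw [hwt]; exact (hγ t ht).2) (hd.add_const e)).clm_apply hdd)
  have hconv : ConvexOn ℝ (Icc (0 : ℝ) 1) (fun t => Ψ (w t) - Ψ (w t + e)) :=
    convexOn_of_hasDerivWithinAt2_nonneg (convex_Icc 0 1)
      (fun s hs => (hd1 s hs).continuousAt.continuousWithinAt)
      (fun s hs => (hd1 s (interior_subset hs)).hasDerivWithinAt)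
      (fun s hs => (hd2 s (interior_subset hs)).hasDerivWithinAt)
      (fun s hs => by
        obtain ⟨hwt, -, -, hz⟩ := hw' s (interior_subset hs)
        refine sub_nonneg.2 (h.second_variation_nonneg hA ?_ ?_ ?_ hz)
        · rw [hwt]; exact (hγ s (interior_subset hs)).1
        · rw [hwt]; exact (hγ s (interior_subset hs)).2
        · rw [hwt]; exact hseg s (interior_subset hs))
  have h0 : (0 : ℝ) ∈ Icc (0 : ℝ) 1 := by simp
  have h1 : (1 : ℝ) ∈ Icc (0 : ℝ) 1 := by simp
  have := hconv.2 h0 h1 (sub_nonneg.2 ht.2) ht.1 (sub_add_cancel 1 t)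
  simp only [smul_eq_mul, mul_zero, mul_one, zero_add, (hw' 0 h0).1, (hw' 1 h1).1,
    (hw' t ht).1] at this
  linarith

/-! ### Second variation: from convexity to curvature -/

/-- Midpoint convexity along short curves with affine gradient forces the second variation to be
non-negative. -/
theorem exists_second_variation_nonneg {z b : E} {ε : ℝ} (hε : 0 < ε) (hball : ball z (2 * ε) ⊆ Ω)
    (hmid : ∀ w : ℝ → E, (∀ τ ∈ Icc (0 : ℝ) 1, w τ ∈ ball z ε ∧
      fderiv ℝ Ψ (w τ) = (1 - τ) • fderiv ℝ Ψ (w 0) + τ • fderiv ℝ Ψ (w 1)) →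
      ∀ e : E, ‖e‖ < ε → (Ψ (w 2⁻¹) - Ψ (w 2⁻¹ + e)) - (Ψ (w 0) - Ψ (w 0 + e)) ≤
        2⁻¹ * ((Ψ (w 1) - Ψ (w 1 + e)) - (Ψ (w 0) - Ψ (w 0 + e)))) :
    ∃ w₂ : E, third Ψ z b b + hess Ψ z w₂ = 0 ∧ ∀ e : E, ‖e‖ < ε →
      hess Ψ (z + e) b b + fderiv ℝ Ψ (z + e) w₂ ≤ hess Ψ z b b + fderiv ℝ Ψ z w₂ := by
  have hz : z ∈ Ω := hball (mem_ball_self (by linarith))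
  obtain ⟨w, w₁, w₂, hU, hw⟩ := h.exists_gradient_curve (fderiv ℝ Ψ z) (hess Ψ z b)
  have himg0 : fderiv ℝ Ψ z + (0 : ℝ) • hess Ψ z b ∈ fderiv ℝ Ψ '' Ω := ⟨z, hz, by simp⟩
  obtain ⟨hm0, hF0, hd0, hdd0, hq0, hz0⟩ := hw 0 himg0
  have hw0 : w 0 = z := h.injOn_fderiv hm0 hz (by rw [hF0]; simp)
  have hw10 : w₁ 0 = b := by
    obtain ⟨L, hL⟩ := h.exists_equiv hz
    rw [hw0, ← hL] at hq0
    exact L.injective hq0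
  rw [hw0, hw10] at hz0
  refine ⟨w₂ 0, hz0, fun e he => ?_⟩
  have hev : ∀ᶠ t in 𝓝 (0 : ℝ),
      fderiv ℝ Ψ z + t • hess Ψ z b ∈ fderiv ℝ Ψ '' Ω ∧ w t ∈ ball z ε :=
    Filter.Eventually.and (hU.mem_nhds himg0)
      (hd0.continuousAt.eventually_mem (isOpen_ball.mem_nhds (by simpa [hw0] using hε)))
  obtain ⟨δ, hδ, hδ'⟩ := Metric.eventually_nhds_iff_ball.1 hev
  have hshift : ∀ x ∈ ball z ε, x ∈ Ω ∧ x + e ∈ Ω := fun x hx => by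
    rw [mem_ball, dist_eq_norm] at hx
    refine ⟨hball ?_, hball ?_⟩ <;> rw [mem_ball, dist_eq_norm]
    · linarith
    · have : x + e - z = (x - z) + e := by abel
      rw [this]
      linarith [norm_add_le (x - z) e]
  have hd1 : ∀ t ∈ ball (0 : ℝ) δ, HasDerivAt (fun t => Ψ (w t) - Ψ (w t + e))
      (fderiv ℝ Ψ (w t) (w₁ t) - fderiv ℝ Ψ (w t + e) (w₁ t)) t := fun t ht => by
    obtain ⟨hi, hb⟩ := hδ' t ht
    have hd := (hw t hi).2.2.1
    exact (h.contDiffOn.hasDerivAt_comp h.isOpen (hshift _ hb).1 hd).sub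
      (h.contDiffOn.hasDerivAt_comp (w := fun t => w t + e) h.isOpen (hshift _ hb).2
        (hd.add_const e))
  have hd2 : HasDerivAt (fun t => fderiv ℝ Ψ (w t) (w₁ t) - fderiv ℝ Ψ (w t + e) (w₁ t))
      ((hess Ψ z b b + fderiv ℝ Ψ z (w₂ 0)) -
        (hess Ψ (z + e) b b + fderiv ℝ Ψ (z + e) (w₂ 0))) 0 := by
    have hb : w 0 ∈ ball z ε := by simpa [hw0] using hε
    have := ((h.contDiffOn.hasDerivAt_fderiv_comp h.isOpen (hshift _ hb).1 hd0).clm_apply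
      hdd0).sub ((h.contDiffOn.hasDerivAt_fderiv_comp (w := fun t => w t + e) h.isOpen
        (hshift _ hb).2 (hd0.add_const e)).clm_apply hdd0)
    exact this.congr_deriv (by simp only [hw0, hw10])
  have hball0 : ball (0 : ℝ) δ ∈ 𝓝 (0 : ℝ) := ball_mem_nhds 0 hδ
  have hneg : ∀ t ∈ ball (0 : ℝ) δ, -t ∈ ball (0 : ℝ) δ := fun t ht => by simpa using ht
  have hmin : IsLocalMin (fun t => (Ψ (w t) - Ψ (w t + e)) + (Ψ (w (-t)) - Ψ (w (-t) + e))) 0 := by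
    filter_upwards [hball0] with t ht
    have hmem : ∀ τ ∈ Icc (0 : ℝ) 1, (2 * τ - 1) * t ∈ ball (0 : ℝ) δ := fun τ hτ => by
      rw [mem_ball_zero_iff, Real.norm_eq_abs] at ht ⊢
      rw [abs_mul]
      have : |2 * τ - 1| ≤ 1 := abs_le.2 ⟨by linarith [hτ.1], by linarith [hτ.2]⟩
      nlinarith [abs_nonneg t]
    have hF : ∀ τ ∈ Icc (0 : ℝ) 1, fderiv ℝ Ψ (w ((2 * τ - 1) * t)) =
        fderiv ℝ Ψ z + ((2 * τ - 1) * t) • hess Ψ z b := fun τ hτ =>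
      (hw _ (hδ' _ (hmem τ hτ)).1).2.1
    -- The curve is reparametrised to run from -t to t, so that its midpoint is w 0 = z.
    have := hmid (fun τ => w ((2 * τ - 1) * t)) (fun τ hτ => ⟨(hδ' _ (hmem τ hτ)).2, by
      rw [hF τ hτ, hF 0 (by simp), hF 1 (by simp)]; module⟩) e he
    norm_num at this
    simp only [neg_zero]
    linarith
  have hd2' := hd2
  rw [← neg_zero (G := ℝ)] at hd2'
  have := hmin.second_deriv_nonneg
    (f' := fun t => (fderiv ℝ Ψ (w t) (w₁ t) - fderiv ℝ Ψ (w t + e) (w₁ t)) -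
      (fderiv ℝ Ψ (w (-t)) (w₁ (-t)) - fderiv ℝ Ψ (w (-t) + e) (w₁ (-t))))
    (by
      filter_upwards [hball0] with t ht
      exact ((hd1 t ht).add ((hd1 (-t) (hneg t ht)).comp t (hasDerivAt_neg t))).congr_deriv
        (by ring))
    (hd2.sub (hd2'.comp (0 : ℝ) (hasDerivAt_neg (0 : ℝ))))
  rw [neg_zero] at this
  linarith

/-- The second variation makes z a local maximum of y ↦ D²Ψ(y)(b, b) + DΨ(y)w₂. Since z is a
critical point, straight lines z + sa serve as well as gradient curves for the second-order test. -/
theorem antiBisectional_nonneg_at {z : E} {ε : ℝ} (hε : 0 < ε) (hball : ball z (2 * ε) ⊆ Ω)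
    (hmid : ∀ w : ℝ → E, (∀ τ ∈ Icc (0 : ℝ) 1, w τ ∈ ball z ε ∧
      fderiv ℝ Ψ (w τ) = (1 - τ) • fderiv ℝ Ψ (w 0) + τ • fderiv ℝ Ψ (w 1)) →
      ∀ e : E, ‖e‖ < ε → (Ψ (w 2⁻¹) - Ψ (w 2⁻¹ + e)) - (Ψ (w 0) - Ψ (w 0 + e)) ≤
        2⁻¹ * ((Ψ (w 1) - Ψ (w 1 + e)) - (Ψ (w 0) - Ψ (w 0 + e))))
    {a b k : E} (hk : hess Ψ z k = third Ψ z a a) :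
    0 ≤ -fourth Ψ z a a b b + third Ψ z b b k := by
  have hz : z ∈ Ω := hball (mem_ball_self (by linarith))
  obtain ⟨w₂, hw₂, hvar⟩ := h.exists_second_variation_nonneg (b := b) hε hball hmid
  have hc : ContinuousAt (fun s : ℝ => s • a) 0 := by fun_prop
  have hev : ∀ᶠ s : ℝ in 𝓝 0, s • a ∈ ball (0 : E) ε :=
    hc.eventually_mem (isOpen_ball.mem_nhds (by simpa using hε))
  have hmem : ∀ s : ℝ, s • a ∈ ball (0 : E) ε → z + s • a ∈ Ω := fun s hs => hball (by
    rw [mem_ball_zero_iff] at hs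
    rw [mem_ball, dist_eq_norm, add_sub_cancel_left]
    linarith)
  have hmin : IsLocalMin
      (fun s : ℝ => -(hess Ψ (z + s • a) b b + fderiv ℝ Ψ (z + s • a) w₂)) 0 := by
    filter_upwards [hev] with s hs
    have := hvar _ (mem_ball_zero_iff.1 hs)
    simp only [zero_smul, add_zero]
    linarith
  have hd1 : ∀ᶠ s : ℝ in 𝓝 0, HasDerivAt
      (fun s : ℝ => -(hess Ψ (z + s • a) b b + fderiv ℝ Ψ (z + s • a) w₂))
      (-(third Ψ (z + s • a) a b b + hess Ψ (z + s • a) a w₂)) s := by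
    filter_upwards [hev] with s hs
    have e1 := ((h.contDiffOn.hasDerivAt_hess_comp h.isOpen (hmem s hs)
      (hasDerivAt_line z a s)).clm_apply (hasDerivAt_const s b)).clm_apply (hasDerivAt_const s b)
    have e2 := (h.contDiffOn.hasDerivAt_fderiv_comp h.isOpen (hmem s hs)
      (hasDerivAt_line z a s)).clm_apply (hasDerivAt_const s w₂)
    exact (e1.add e2).neg.congr_deriv (by simp)
  have hz0 : z + (0 : ℝ) • a ∈ Ω := by simpa using hz
  have hd2 : HasDerivAt (fun s : ℝ => -(third Ψ (z + s • a) a b b + hess Ψ (z + s • a) a w₂))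
      (-(fourth Ψ z a a b b + third Ψ z a a w₂)) 0 := by
    have e1 := (((h.contDiffOn.hasDerivAt_third_comp h.isOpen hz0
      (hasDerivAt_line z a 0)).clm_apply (hasDerivAt_const 0 a)).clm_apply
        (hasDerivAt_const 0 b)).clm_apply (hasDerivAt_const 0 b)
    have e2 := ((h.contDiffOn.hasDerivAt_hess_comp h.isOpen hz0
      (hasDerivAt_line z a 0)).clm_apply (hasDerivAt_const 0 a)).clm_apply
        (hasDerivAt_const 0 w₂)
    exact (e1.add e2).neg.congr_deriv (by simp)
  have := hmin.second_deriv_nonneg hd1 hd2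
  -- Testing the equation for w₂ on k trades D³Ψ(a, a, w₂) = D²Ψ(k, w₂) for -D³Ψ(b, b, k).
  have e := congrArg (fun L => L k) hw₂
  simp only [add_apply, zero_apply] at e
  rw [h.contDiffOn.hess_symm h.isOpen hz, hk] at e
  linarith

end CoerciveHessianOn

end Calculus

/-! ### Coordinates, and the cost on pairs of balls -/

section Euclidean

variable {n : ℕ}

local notation "𝔼" => EuclideanSpace ℝ (Fin n)

theorem iteratedFDeriv_three_apply (Ψ : 𝔼 → ℝ) (x a b c : 𝔼) :
    iteratedFDeriv ℝ 3 Ψ x ![a, b, c] = third Ψ x a b c := by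
  rw [iteratedFDeriv_succ_apply_right, iteratedFDeriv_two_apply]
  rfl

theorem iteratedFDeriv_four_apply (Ψ : 𝔼 → ℝ) (x a b c d : 𝔼) :
    iteratedFDeriv ℝ 4 Ψ x ![a, b, c, d] = fourth Ψ x a b c d := by
  rw [iteratedFDeriv_succ_apply_right, iteratedFDeriv_succ_apply_right, iteratedFDeriv_two_apply]
  rfl

theorem third_le_of_norm_le {Ψ : 𝔼 → ℝ} {x : 𝔼} {C : ℝ} (hC : ‖iteratedFDeriv ℝ 3 Ψ x‖ ≤ C)
    (a b : 𝔼) : third Ψ x a a b ≤ C * ‖a‖ ^ 2 * ‖b‖ := by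
  have h1 := (iteratedFDeriv ℝ 3 Ψ x).le_opNorm ![a, a, b]
  rw [iteratedFDeriv_three_apply] at h1
  simp only [Fin.prod_univ_three, Matrix.cons_val] at h1
  calc third Ψ x a a b ≤ _ := (le_abs_self _).trans h1
    _ ≤ C * (‖a‖ * ‖a‖ * ‖b‖) := by gcongr
    _ = C * ‖a‖ ^ 2 * ‖b‖ := by ring

theorem sum_smul_coordVec (u : 𝔼) : ∑ i, u i • coordVec i = u := by
  simpa [coordVec] using (EuclideanSpace.basisFun (Fin n) ℝ).sum_repr u

theorem clm_apply_apply_eq_sum {G : Type*} [NormedAddCommGroup G] [NormedSpace ℝ G]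
    (B : 𝔼 →L[ℝ] 𝔼 →L[ℝ] G) (u v : 𝔼) :
    B u v = ∑ i, ∑ j, (u i * v j) • B (coordVec i) (coordVec j) := by
  conv_lhs => rw [← sum_smul_coordVec u, ← sum_smul_coordVec v]
  simp only [map_sum, map_smul, sum_apply, smul_apply, Finset.smul_sum]
  rw [Finset.sum_comm]
  exact Finset.sum_congr rfl fun i _ => Finset.sum_congr rfl fun j _ => by rw [mul_comm, mul_smul]

variable {Ω : Set (EuclideanSpace ℝ (Fin n))} {Ψ : EuclideanSpace ℝ (Fin n) → ℝ} {m : ℝ}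

/-- The inverse metric pairs the coordinates of linear forms. -/
theorem CoerciveHessianOn.sum_inv_metric (h : CoerciveHessianOn Ω Ψ m) {x : 𝔼} (hx : x ∈ Ω) {k : 𝔼}
    {α : 𝔼 →L[ℝ] ℝ} (hk : hess Ψ x k = α) (β : 𝔼 →L[ℝ] ℝ) :
    ∑ p, ∑ q, α (coordVec p) * β (coordVec q) * (kahlerSasakiMetric Ψ x)⁻¹ p q = β k := by
  set M := kahlerSasakiMetric Ψ x with hM
  have hMe : ∀ p q, M p q = hess Ψ x (coordVec p) (coordVec q) := fun p q => by
    simp only [hM, kahlerSasakiMetric, partial₂, Matrix.of_apply, iteratedFDeriv_two_apply]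
    rfl
  have hsymm : M.transpose = M := by
    ext p q
    rw [Matrix.transpose_apply, hMe, hMe, h.contDiffOn.hess_symm h.isOpen hx]
  have hmul : ∀ (v : 𝔼) p, M.mulVec (fun q => v q) p = hess Ψ x v (coordVec p) := fun v p => by
    rw [h.contDiffOn.hess_symm h.isOpen hx]
    conv_rhs => rw [← sum_smul_coordVec v]
    simp only [Matrix.mulVec, dotProduct, map_sum, map_smul, smul_eq_mul, hMe, mul_comm]
  have hunit : IsUnit M := by
    rw [← Matrix.mulVec_injective_iff_isUnit]
    intro f g hfg
    obtain ⟨L, hL⟩ := h.exists_equiv hx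
    have : L (WithLp.toLp 2 f) = L (WithLp.toLp 2 g) := by
      ext v
      rw [← sum_smul_coordVec v]
      simp only [map_sum, map_smul]
      refine Finset.sum_congr rfl fun p _ => ?_
      have h1 := hmul (WithLp.toLp 2 f) p
      have h2 := hmul (WithLp.toLp 2 g) p
      have h3 : M.mulVec f p = M.mulVec g p := congrFun hfg p
      have h4 : hess Ψ x (WithLp.toLp 2 f) (coordVec p) =
        hess Ψ x (WithLp.toLp 2 g) (coordVec p) := h1.symm.trans (h3.trans h2)
      rw [← hL] at h4
      exact congrArg (v p • ·) h4
    exact congrArg WithLp.ofLp (L.injective this)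
  have hα : (fun p => α (coordVec p)) = M.mulVec fun q => k q := by
    ext p; rw [hmul, hk]
  calc ∑ p, ∑ q, α (coordVec p) * β (coordVec q) * M⁻¹ p q
      = (fun p => α (coordVec p)) ⬝ᵥ M⁻¹.mulVec fun q => β (coordVec q) := by
        simp only [Matrix.mulVec, dotProduct, Finset.mul_sum]
        exact Finset.sum_congr rfl fun p _ => Finset.sum_congr rfl fun q _ => by ring
    _ = (fun q => k q) ⬝ᵥ (fun q => β (coordVec q)) := by
        rw [hα, ← Matrix.vecMul_transpose, ← Matrix.dotProduct_mulVec, hsymm, Matrix.mulVec_mulVec,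
          Matrix.mul_nonsing_inv _ ((Matrix.isUnit_iff_isUnit_det M).1 hunit), Matrix.one_mulVec]
    _ = β k := by
        conv_rhs => rw [← sum_smul_coordVec k]
        simp [dotProduct]

/-- Since k depends linearly on the form D³Ψ(u, u), the contraction with the inverse metric can be
matched term by term for the forms D³Ψ(e_i, e_j). -/
theorem CoerciveHessianOn.antiBisectional_eq (h : CoerciveHessianOn Ω Ψ m) {x : 𝔼} (hx : x ∈ Ω)
    {u v k : 𝔼} (hk : hess Ψ x k = third Ψ x u u) :
    antiBisectional Ψ x u v = -fourth Ψ x u u v v + third Ψ x v v k := by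
  obtain ⟨L, hL⟩ := h.exists_equiv hx
  have hLk : ∀ α, hess Ψ x (L.symm α) = α := fun α => by rw [← hL]; simp
  have hk' : k = ∑ i, ∑ j, (u i * u j) • L.symm (third Ψ x (coordVec i) (coordVec j)) := by
    have : k = L.symm (third Ψ x u u) := by
      apply L.injective
      rw [L.apply_symm_apply, ← hk, ← hL]; rfl
    rw [this, clm_apply_apply_eq_sum (third Ψ x) u u]
    simp only [map_sum, map_smul]
  have h1 : fourth Ψ x u u v v = ∑ i, ∑ j, ∑ k, ∑ l, (u i * u j) * ((v k * v l) *
      fourth Ψ x (coordVec i) (coordVec j) (coordVec k) (coordVec l)) := by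
    rw [clm_apply_apply_eq_sum (fourth Ψ x) u u]
    simp only [sum_apply, smul_apply]
    refine Finset.sum_congr rfl fun i _ => Finset.sum_congr rfl fun j _ => ?_
    rw [clm_apply_apply_eq_sum (fourth Ψ x (coordVec i) (coordVec j)) v v]
    simp only [smul_eq_mul, Finset.mul_sum]
  have h2 : third Ψ x v v k = ∑ i, ∑ j, ∑ k, ∑ l, (u i * u j) * ((v k * v l) *
      third Ψ x (coordVec k) (coordVec l)
        (L.symm (third Ψ x (coordVec i) (coordVec j)))) := by
    rw [hk']
    simp only [map_sum, map_smul]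
    refine Finset.sum_congr rfl fun i _ => Finset.sum_congr rfl fun j _ => ?_
    rw [clm_apply_apply_eq_sum (third Ψ x) v v]
    simp only [sum_apply, smul_apply, smul_eq_mul, Finset.mul_sum]
  rw [h1, h2]
  simp only [antiBisectional, ← Finset.sum_neg_distrib, ← Finset.sum_add_distrib]
  refine Finset.sum_congr rfl fun i _ => Finset.sum_congr rfl fun j _ =>
    Finset.sum_congr rfl fun k _ => Finset.sum_congr rfl fun l _ => ?_
  simp only [partial₃, partial₄, iteratedFDeriv_three_apply, iteratedFDeriv_four_apply]
  rw [h.sum_inv_metric hx (hLk (third Ψ x (coordVec i) (coordVec j)))]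
  ring

theorem CoerciveHessianOn.hasNAB_iff (h : CoerciveHessianOn Ω Ψ m) :
    HasNAB Ω Ψ ↔ NonnegAntiBisectional Ω Ψ := by
  constructor
  · intro hN x hx a b k hk
    rw [← h.antiBisectional_eq hx hk]
    have := hN (WithLp.toLp 2 fun i => (x i : ℂ)) (by simpa [tubeDomain] using hx) a b
    simpa using this
  · intro hN z hz u v
    obtain ⟨k, hk⟩ := h.exists_hess_eq hz (third Ψ _ u u)
    rw [h.antiBisectional_eq hz hk]
    exact hN _ hz u v k hk

theorem fderiv_psiCost_left (Ψ : 𝔼 → ℝ) (x y : 𝔼) :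
    fderiv ℝ (fun x => psiCost Ψ x y) x = fderiv ℝ Ψ (x - y) := fderiv_comp_sub y

theorem fderiv_psiCost_right (Ψ : 𝔼 → ℝ) (x y : 𝔼) :
    fderiv ℝ (fun y => psiCost Ψ x y) y = -fderiv ℝ Ψ (x - y) := by
  have : (fun y => psiCost Ψ x y) = fun y => (fun v => Ψ (-v)) (y - x) := by
    ext y; simp [psiCost]
  rw [this, fderiv_comp_sub (f := fun v => Ψ (-v)) x]
  have hneg := (ContinuousLinearEquiv.neg ℝ (M := 𝔼)).comp_right_fderiv (f := Ψ) (x := y - x)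
  ext v
  simpa [Function.comp_def] using congrArg (fun L => L v) hneg

theorem CoerciveHessianOn.exists_segment (h : CoerciveHessianOn Ω Ψ m) {z : 𝔼} {R C : ℝ}
    (hball : ball z R ⊆ Ω) (hC0 : 0 ≤ C)
    (hC : ∀ x ∈ ball z R, ∀ a b, third Ψ x a a b ≤ C * ‖a‖ ^ 2 * ‖b‖) (hR : 2 * R * C < m)
    {a b : 𝔼} (ha : a ∈ ball z R) (hb : b ∈ ball z R) :
    ∃ w : ℝ → 𝔼, w 0 = a ∧ w 1 = b ∧ ∀ t ∈ Icc (0 : ℝ) 1, w t ∈ ball z R ∧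
      fderiv ℝ Ψ (w t) = (1 - t) • fderiv ℝ Ψ a + t • fderiv ℝ Ψ b := by
  have := fun t : ℝ => fun ht : t ∈ Icc (0 : ℝ) 1 =>
    h.exists_fderiv_eq_of_ball hball hC0 hC hR ha hb ht
  choose! w hw hF using this
  refine ⟨w, ?_, ?_, fun t ht => ⟨hw t ht, hF t ht⟩⟩
  · exact h.injOn_fderiv (hball (hw 0 (by simp))) (hball ha) (by rw [hF 0 (by simp)]; simp)
  · exact h.injOn_fderiv (hball (hw 1 (by simp))) (hball hb) (by rw [hF 1 (by simp)]; simp)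

/-- Non-negative curvature gives quantitative convexity on balls which are small compared with the
bound on the third derivatives. -/
theorem CoerciveHessianOn.quantConv (h : CoerciveHessianOn Ω Ψ m)
    (hA : NonnegAntiBisectional Ω Ψ) {x₁ x₂ : 𝔼} {ε C : ℝ} (hε : 0 < ε)
    (hsub : ball x₁ ε - ball x₂ ε ⊆ Ω) (hC0 : 0 ≤ C)
    (hC : ∀ x ∈ ball x₁ ε - ball x₂ ε, ‖iteratedFDeriv ℝ 3 Ψ x‖ ≤ C) (hR : 4 * ε * C < m) :
    QuantConv (psiCost Ψ) (ball x₁ ε) (ball x₂ ε) := by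
  have hmem : ∀ {x y}, x ∈ ball x₁ ε → y ∈ ball x₂ ε → x - y ∈ ball x₁ ε - ball x₂ ε :=
    fun hx hy => sub_mem_sub hx hy
  have hD := ball_sub_ball hε hε x₁ x₂
  have hC3 : ∀ x ∈ ball x₁ ε - ball x₂ ε, ∀ a b, third Ψ x a a b ≤ C * ‖a‖ ^ 2 * ‖b‖ :=
    fun x hx a b => third_le_of_norm_le (hC x hx) a b
  -- Segments must stay in one ball, so they live in a translate of radius ε; the connecting curves
  -- of `hlarge` only need the difference ball, whose radius 2ε gives the condition 4εC < m.
  have hsmall : ∀ {z : 𝔼}, ball z ε ⊆ ball x₁ ε - ball x₂ ε → ∀ {a b : 𝔼}, a ∈ ball z ε →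
      b ∈ ball z ε → ∃ w : ℝ → 𝔼, w 0 = a ∧ w 1 = b ∧ ∀ t ∈ Icc (0 : ℝ) 1, w t ∈ ball z ε ∧
      fderiv ℝ Ψ (w t) = (1 - t) • fderiv ℝ Ψ a + t • fderiv ℝ Ψ b := fun hz _ _ ha hb =>
    h.exists_segment (hz.trans hsub) hC0 (fun x hx => hC3 x (hz hx)) (by nlinarith) ha hb
  have hlarge : ∀ {a b : 𝔼}, a ∈ ball x₁ ε - ball x₂ ε → b ∈ ball x₁ ε - ball x₂ ε →
      ∀ t ∈ Icc (0 : ℝ) 1, ∃ c ∈ Ω,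
      fderiv ℝ Ψ c = (1 - t) • fderiv ℝ Ψ a + t • fderiv ℝ Ψ b := fun ha hb t ht => by
    rw [hD] at hsub hC3 ha hb
    obtain ⟨c, hc, he⟩ := h.exists_fderiv_eq_of_ball hsub hC0 hC3 (by linarith) ha hb ht
    exact ⟨c, hsub hc, he⟩
  refine ⟨fun x₀ hx₀ y₀ hy₀ y₁ hy₁ => ⟨?_, fun γ hγ x hx t ht => ?_⟩,
    fun y₀ hy₀ x₀ hx₀ z₁ hz₁ => ⟨?_, fun σ hσ y hy s hs => ?_⟩⟩
  · have hiff : ∀ v, v ∈ ball (x₀ - x₂) ε ↔ x₀ - v ∈ ball x₂ ε := fun v => by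
      rw [mem_ball, mem_ball, dist_eq_norm, dist_eq_norm, ← norm_neg]
      congr! 2; abel
    obtain ⟨w, hw0, hw1, hw⟩ := hsmall (z := x₀ - x₂) (a := x₀ - y₀) (b := x₀ - y₁)
      (fun v hv => by simpa using hmem hx₀ ((hiff v).1 hv)) ((hiff _).2 (by simpa using hy₀))
      ((hiff _).2 (by simpa using hy₁))
    refine ⟨fun t => x₀ - w t, by simp [hw0], by simp [hw1], fun t ht =>
      ⟨(hiff _).1 (hw t ht).1, ?_⟩⟩
    simp only [fderiv_psiCost_left, sub_sub_cancel]
    exact (hw t ht).2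
  · obtain ⟨hγ0, hγ1, hγt⟩ := hγ
    simp only [fderiv_psiCost_left] at hγt
    have := h.sub_le_of_nonneg hA (γ := fun t => x₀ - γ t) (e := x - x₀)
      (fun t ht => ⟨hsub (hmem hx₀ (hγt t ht).1), by
        simpa using hsub (hmem hx (hγt t ht).1)⟩)
      (fun t ht => by rw [hγ0, hγ1]; exact (hγt t ht).2)
      (fun t ht => hlarge (hmem hx₀ (hγt t ht).1) (by simpa using hmem hx (hγt t ht).1)) ht
    simp only [hγ0, hγ1, sub_add_sub_cancel'] at this
    simp only [psiCost]
    linarith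
  · have hiff : ∀ v, v ∈ ball (x₁ - y₀) ε ↔ v + y₀ ∈ ball x₁ ε := fun v => by
      rw [mem_ball, mem_ball, dist_eq_norm, dist_eq_norm]
      congr! 2; abel
    obtain ⟨w, hw0, hw1, hw⟩ := hsmall (z := x₁ - y₀) (a := x₀ - y₀) (b := z₁ - y₀)
      (fun v hv => by simpa using hmem ((hiff v).1 hv) hy₀) ((hiff _).2 (by simpa using hx₀))
      ((hiff _).2 (by simpa using hz₁))
    refine ⟨fun t => w t + y₀, by simp [hw0], by simp [hw1], fun t ht =>
      ⟨(hiff _).1 (hw t ht).1, ?_⟩⟩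
    simp only [fderiv_psiCost_right, add_sub_cancel_right]
    rw [(hw t ht).2]; module
  · obtain ⟨hσ0, hσ1, hσt⟩ := hσ
    simp only [fderiv_psiCost_right] at hσt
    have := h.sub_le_of_nonneg hA (γ := fun t => σ t - y₀) (e := y₀ - y)
      (fun t ht => ⟨hsub (hmem (hσt t ht).1 hy₀), by
        simpa using hsub (hmem (hσt t ht).1 hy)⟩)
      (fun t ht => by
        rw [hσ0, hσ1, ← neg_inj, (hσt t ht).2]; module)
      (fun t ht => hlarge (hmem (hσt t ht).1 hy₀) (by simpa using hmem (hσt t ht).1 hy)) hs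
    simp only [hσ0, hσ1, sub_add_sub_cancel] at this
    simp only [psiCost]
    linarith

/-- Quantitative convexity on a pair of balls gives non-negative curvature at the difference of the
centres. -/
theorem CoerciveHessianOn.nonneg_of_quantConv (h : CoerciveHessianOn Ω Ψ m)
    (hQ : ∀ z ∈ Ω, ∃ ε > (0 : ℝ), ball z ε - ball 0 ε ⊆ Ω ∧
      QuantConv (psiCost Ψ) (ball z ε) (ball 0 ε)) : NonnegAntiBisectional Ω Ψ := by
  intro z hz a b k hk
  obtain ⟨ε, hε, hsub, hq, -⟩ := hQ z hz
  have hD := ball_sub_ball hε hε z 0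
  rw [sub_zero, ← two_mul] at hD
  refine h.antiBisectional_nonneg_at hε (hD ▸ hsub) (fun w hw e he => ?_) hk
  have hmem : ∀ τ ∈ Icc (0 : ℝ) 1, z - w τ ∈ ball (0 : 𝔼) ε := fun τ hτ => by
    rw [mem_ball_zero_iff, norm_sub_rev, ← dist_eq_norm]; exact (hw τ hτ).1
  -- Only the first condition is used, with x₀ = z and x = z + e.
  have := (hq z (mem_ball_self hε) (z - w 0) (hmem 0 (by simp)) (z - w 1) (hmem 1 (by simp))).2
    (fun τ => z - w τ) ⟨rfl, rfl, fun τ hτ => ⟨hmem τ hτ, by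
      simp only [fderiv_psiCost_left, sub_sub_cancel]; exact (hw τ hτ).2⟩⟩ (z + e)
    (by simpa [dist_eq_norm] using he) 2⁻¹ (by norm_num)
  have hs : ∀ τ, z + e - (z - w τ) = w τ + e := fun τ => by abel
  simp only [psiCost, sub_sub_cancel, hs] at this
  linarith

end Euclidean

/-! ### The three equivalences and implications -/

theorem corollary6p7 {n : ℕ} (Ω : Set (EuclideanSpace ℝ (Fin n))) (hΩ : IsOpen Ω)
    (hΩc : Convex ℝ Ω) (Ψ : EuclideanSpace ℝ (Fin n) → ℝ) (hΨ : ContDiffOn ℝ 4 Ψ Ω)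
    (hconv : ∃ m > (0 : ℝ), StrongConvexOn Ω m Ψ) :
    (HasNAB Ω Ψ ↔ QuantConvLocally Ω Ψ) ∧
    (QuantConvOnSmallBalls Ω Ψ → HasNAB Ω Ψ) ∧
    ((∃ C : ℝ, ∀ x ∈ Ω, ‖iteratedFDeriv ℝ 3 Ψ x‖ ≤ C) →
      (HasNAB Ω Ψ ↔ QuantConvOnSmallBalls Ω Ψ)) := by
  obtain ⟨m, hm, hsc⟩ := hconv
  have h := hsc.coerciveHessianOn hm hΩ hΩc hΨ
  have hU : QuantConvOnSmallBalls Ω Ψ → HasNAB Ω Ψ := by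
    rintro ⟨ε₀, hε₀, hq⟩
    refine h.hasNAB_iff.2 (h.nonneg_of_quantConv fun z hz => ?_)
    obtain ⟨δ, hδ, hδΩ⟩ := Metric.isOpen_iff.1 hΩ z hz
    have hε : 0 < min (ε₀ / 2) (δ / 2) := by positivity
    have hsub : ball z (min (ε₀ / 2) (δ / 2)) - ball 0 (min (ε₀ / 2) (δ / 2)) ⊆ Ω := by
      rw [ball_sub_ball hε hε, sub_zero]
      exact (ball_subset_ball (by linarith [min_le_right (ε₀ / 2) (δ / 2)])).trans hδΩ
    exact ⟨_, hε, hsub, hq _ hε (by linarith [min_le_left (ε₀ / 2) (δ / 2)]) z 0 hsub⟩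
  refine ⟨⟨fun hN K hK hKΩ => ?_, fun hq => ?_⟩, hU, fun ⟨C, hC⟩ => ⟨fun hN => ?_, hU⟩⟩
  · obtain ⟨δ, hδ, hδΩ⟩ := hK.exists_cthickening_subset_open hΩ hKΩ
    have hcont : ContinuousOn (iteratedFDeriv ℝ 3 Ψ) (cthickening δ K) := fun x hx =>
      (((hΨ.contDiffAt (hΩ.mem_nhds (hδΩ hx))).iteratedFDeriv_right (m := 0) (i := 3)
        (by norm_num)).continuousAt).continuousWithinAt
    obtain ⟨C, hC⟩ := hK.cthickening.exists_bound_of_continuousOn hcont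
    -- The first entry keeps the difference ball, of radius 2ε, inside the δ-thickening of K; the
    -- second gives 4εC < m, with |C| + 1 avoiding a zero denominator.
    have hε : 0 < min (δ / 2) (m / (4 * (|C| + 1)) / 2) := by positivity
    set ε := min (δ / 2) (m / (4 * (|C| + 1)) / 2) with hεd
    refine ⟨ε, hε, fun x₁ x₂ hx => ?_⟩
    have hsub : ball x₁ ε - ball x₂ ε ⊆ cthickening δ K := by
      rw [ball_sub_ball hε hε]
      refine (ball_subset_ball ?_).trans
        ((ball_subset_thickening hx δ).trans (thickening_subset_cthickening δ K))
      linarith [min_le_left (δ / 2) (m / (4 * (|C| + 1)) / 2)]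
    have hlt : ε < m / (4 * (|C| + 1)) := by
      have : 0 < m / (4 * (|C| + 1)) := by positivity
      linarith [min_le_right (δ / 2) (m / (4 * (|C| + 1)) / 2)]
    rw [lt_div_iff₀ (by positivity)] at hlt
    exact ⟨hsub.trans hδΩ, h.quantConv (h.hasNAB_iff.1 hN) hε (hsub.trans hδΩ) (abs_nonneg C)
      (fun x hx => (hC x (hsub hx)).trans (le_abs_self C)) (by nlinarith)⟩
  · refine h.hasNAB_iff.2 (h.nonneg_of_quantConv fun z hz => ?_)
    obtain ⟨ε, hε, hq'⟩ := hq {z} isCompact_singleton (singleton_subset_iff.2 hz)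
    exact ⟨ε, hε, hq' z 0 (by simp)⟩
  · refine ⟨m / (4 * (|C| + 1)), by positivity, fun ε hε hlt x₁ x₂ hsub => ?_⟩
    rw [lt_div_iff₀ (by positivity)] at hlt
    exact h.quantConv (h.hasNAB_iff.1 hN) hε hsub (abs_nonneg C)
      (fun x hx => (hC x (hsub hx)).trans (le_abs_self C)) (by nlinarith)
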